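/- Let $\Omega\subset\mathbb{R}^2$ be a nonempty open convex set, bounded or unbounded, that is not a polyhedron, in the sense that its closure is not the intersection of finitely many closed half-planes. Then the Nehari theorem fails for $\Omega$. Here $\widehat f(x)=\int_{\mathbb{R}^2} f(y)e^{-2\pi i x\cdot y}\,dy$, extended to $L^2(\mathbb{R}^2)$ and to tempered distributions; $\mathrm{PW}(\Omega)$ is the closed subspace of $L^2(\mathbb{R}^2)$ of the functions $f$ with $\widehat f=0$ almost everywhere outside $\Omega$. A tempered distribution $\phi$ defines the Hankel operator $H_\phi$ on $\mathrm{PW}(\Omega)$, $$\widehat{H_\phi f}(x)=\int_\Omega \widehat f(y)\,\widehat\phi(x+y)\,dy,\qquad x\in\Omega,$$ densely defined on the $f$ with $\widehat f\in C_c^\infty(\Omega)$, the integral being the pairing of $\widehat\phi$ with the test function $z\mapsto\widehat f(z-x)$. The Nehari theorem holds for $\Omega$ if for every tempered distribution $\phi$ such that $H_\phi$ is bounded on $\mathrm{PW}(\Omega)$ (for the $L^2$ norm) there is $\psi\in L^\infty(\mathbb{R}^2)$ with $\widehat\phi=\widehat\psi$ on $2\Omega$. -/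

import Mathlib

open MeasureTheory SchwartzMap FourierTransform
open scoped Pointwise ENNReal

/-- The Paley-Wiener space `PW(Ω)`: the closed subspace of `L²(ℝⁿ)` of the functions whose Fourier
transform lives on `Ω`, that is, vanishes almost everywhere off `Ω`. -/
noncomputable def paleyWiener {n : ℕ} (Ω : Set (EuclideanSpace ℝ (Fin n))) :
    Submodule ℂ (Lp ℂ 2 (volume : Measure (EuclideanSpace ℝ (Fin n)))) where
  carrier := {f | ∀ᵐ x, x ∉ Ω → 𝓕 f x = 0}
  zero_mem' := by
    have h : 𝓕 (0 : Lp ℂ 2 (volume : Measure (EuclideanSpace ℝ (Fin n)))) = 0 :=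
      (Lp.fourierTransformₗᵢ (EuclideanSpace ℝ (Fin n)) ℂ).map_zero
    simp only [Set.mem_ofPred_eq, h]
    filter_upwards [Lp.coeFn_zero ℂ 2 (volume : Measure (EuclideanSpace ℝ (Fin n)))] with x hx _
    exact hx
  add_mem' := by
    intro f g hf hg
    simp only [Set.mem_ofPred_eq, FourierTransform.fourier_add] at *
    filter_upwards [hf, hg, Lp.coeFn_add (𝓕 f) (𝓕 g)] with x h1 h2 h3 hx
    rw [h3, Pi.add_apply, h1 hx, h2 hx, add_zero]
  smul_mem' := by
    intro c f hf
    simp only [Set.mem_ofPred_eq, FourierTransform.fourier_smul] at *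
    filter_upwards [hf, Lp.coeFn_smul c (𝓕 f)] with x h1 h2 hx
    simp [h2, h1 hx]

/-- The dense domain of the Hankel operators on `PW(Ω)`: the functions `f` whose Fourier transform
is smooth with compact support in `Ω` (all such functions are Schwartz functions). -/
def hankelDomain {n : ℕ} (Ω : Set (EuclideanSpace ℝ (Fin n))) :
    Set 𝓢(EuclideanSpace ℝ (Fin n), ℂ) :=
  {f | HasCompactSupport (𝓕 f : 𝓢(EuclideanSpace ℝ (Fin n), ℂ)) ∧
    tsupport (𝓕 f : 𝓢(EuclideanSpace ℝ (Fin n), ℂ)) ⊆ Ω}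

/-- The function `x ↦ ∫ f̂(y) φ̂(x + y) dy`, where the integral is the pairing of the tempered
distribution `φ̂` with the test function `z ↦ f̂(z - x)`. -/
noncomputable def hankelIntegral {n : ℕ} (φ : 𝓢'(EuclideanSpace ℝ (Fin n), ℂ))
    (f : 𝓢(EuclideanSpace ℝ (Fin n), ℂ)) (x : EuclideanSpace ℝ (Fin n)) : ℂ :=
  𝓕 φ (SchwartzMap.compSubConstCLM ℂ x (𝓕 f))

/-- `h = H_φ f`: the function `h` belongs to `PW(Ω)` and `ĥ(x) = ∫_Ω f̂(y) φ̂(x + y) dy` for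
(almost every) `x ∈ Ω`. There is at most one such `h`. -/
def IsHankelImage {n : ℕ} (Ω : Set (EuclideanSpace ℝ (Fin n)))
    (φ : 𝓢'(EuclideanSpace ℝ (Fin n), ℂ)) (f : 𝓢(EuclideanSpace ℝ (Fin n), ℂ))
    (h : Lp ℂ 2 (volume : Measure (EuclideanSpace ℝ (Fin n)))) : Prop :=
  h ∈ paleyWiener Ω ∧ ∀ᵐ x, x ∈ Ω → 𝓕 h x = hankelIntegral φ f x

/-- `φ` generates a bounded Hankel operator on `PW(Ω)`: the densely defined operator `f ↦ H_φ f`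
takes its values in `PW(Ω)` and is bounded for the `L²` norm. -/
def GeneratesBoundedHankel {n : ℕ} (Ω : Set (EuclideanSpace ℝ (Fin n)))
    (φ : 𝓢'(EuclideanSpace ℝ (Fin n), ℂ)) : Prop :=
  ∃ C : ℝ, ∀ f ∈ hankelDomain Ω, ∃ h : Lp ℂ 2 (volume : Measure (EuclideanSpace ℝ (Fin n))),
    IsHankelImage Ω φ f h ∧ ‖h‖ ≤ C * ‖f.toLp 2 (volume : Measure (EuclideanSpace ℝ (Fin n)))‖

/-- Two tempered distributions coincide on the open set `U`. -/
def EqOnOpen {n : ℕ} (u v : 𝓢'(EuclideanSpace ℝ (Fin n), ℂ))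
    (U : Set (EuclideanSpace ℝ (Fin n))) : Prop :=
  ∀ g : 𝓢(EuclideanSpace ℝ (Fin n), ℂ), HasCompactSupport g → tsupport g ⊆ U → u g = v g

/-- The Nehari theorem is true for `Ω`: for every tempered distribution `φ` that generates a bounded
Hankel operator on `PW(Ω)` there is a bounded function `ψ` with `φ̂ = ψ̂` on `2Ω`. -/
def NehariHolds {n : ℕ} (Ω : Set (EuclideanSpace ℝ (Fin n))) : Prop :=
  ∀ φ : 𝓢'(EuclideanSpace ℝ (Fin n), ℂ), GeneratesBoundedHankel Ω φ →
    ∃ ψ : Lp ℂ ∞ (volume : Measure (EuclideanSpace ℝ (Fin n))),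
      EqOnOpen (𝓕 φ) (𝓕 (Lp.toTemperedDistribution ψ)) ((2 : ℝ) • Ω)

/-- A closed half-space `{x | ⟪a, x⟫ ≤ t}` with `a ≠ 0`. -/
def IsClosedHalfSpace {n : ℕ} (H : Set (EuclideanSpace ℝ (Fin n))) : Prop :=
  ∃ (a : EuclideanSpace ℝ (Fin n)) (t : ℝ), a ≠ 0 ∧ H = {x | inner ℝ a x ≤ t}

/-- A polyhedron is an intersection of finitely many closed half-spaces (the empty intersection
is the whole space). -/
def IsPolyhedron {n : ℕ} (K : Set (EuclideanSpace ℝ (Fin n))) : Prop :=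
  ∃ F : Set (Set (EuclideanSpace ℝ (Fin n))), F.Finite ∧ (∀ H ∈ F, IsClosedHalfSpace H) ∧ K = ⋂₀ F

/-!
The proof has a geometric and an analytic half.

Geometry. Fix `x₀ ∈ Ω` and let `L` be the polar body of `Ω` with respect to `x₀`, a compact convex
set. By the bipolar theorem and the Krein-Milman theorem, `closure Ω` is cut out by the half-planes
that belong to the extreme points of `L`, so `L` has infinitely many extreme points when `closure Ω`
is not a polyhedron (`infinite_extremePoints_polarBody`). Infinitely many of them can be arranged in
monotone angular order inside a half-plane. Each of them lies strictly beyond the chord joining its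
neighbours, which makes thin caps of `Ω` in every other of these directions pairwise disjoint
(`exists_disjoint_caps`): there are caps `C i`, and balls `B i` around points of `2 • Ω`, such that
`x + y ∈ B i` with `x, y ∈ Ω` forces both `x` and `y` into `C i`.

Analysis. Take a symbol `Φ` whose Fourier transform is a sum of bumps in the balls `B i`, normalized
in `L¹`. The Hankel form pairs `x` and `y` through `x + y`, so it is block diagonal with respect to
the disjoint caps, and it is bounded because the blocks are uniformly bounded
(`generatesBoundedHankel_of_blocks`). On the other hand, group the bumps in blocks, the `k`-th one
consisting of `k + 1` bumps of the same radius, and test `𝓕 Φ` against `k + 1` narrower bumps of the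
`k`-th block, smeared out by one more bump. Up to a common factor, a power of the radius, the
pairing is of size `k + 1` (`le_norm_integral_mul_smearedBumps`), while by Cauchy-Schwarz and
Plancherel the `L¹` norm of the Fourier transform of the test function is only of size `√(k + 1)`
(`integral_norm_fourier_smearedBumps_le`). Hence no bounded function has the Fourier transform of
`Φ` on `2 • Ω`.

The bumps may accumulate at the boundary of `2 • Ω`, where their sum need not define a distribution.
This is repaired by modulating the blocks, that is, by translating their inverse Fourier transforms
far away (`exists_translate_norm_le`), which affects none of the above.
-/

/-! ### Polar bodies and disjoint caps -/

section Polar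

variable {n : ℕ}

/-- The polar body of `Ω` with respect to the base point `x₀`, in the one-sided convention
`⟪a, x - x₀⟫ ≤ 1` without absolute value, so that `Ω` need not be symmetric. -/
def polarBody (Ω : Set (EuclideanSpace ℝ (Fin n))) (x₀ : EuclideanSpace ℝ (Fin n)) :
    Set (EuclideanSpace ℝ (Fin n)) :=
  {a | ∀ x ∈ Ω, inner ℝ a (x - x₀) ≤ 1}

variable {Ω : Set (EuclideanSpace ℝ (Fin n))} {x₀ : EuclideanSpace ℝ (Fin n)}

lemma convex_setOf_inner_le (y : EuclideanSpace ℝ (Fin n)) (t : ℝ) :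
    Convex ℝ {a : EuclideanSpace ℝ (Fin n) | inner ℝ a y ≤ t} :=
  convex_halfSpace_le ⟨fun a b => inner_add_left a b y, fun c a => real_inner_smul_left a y c⟩ t

lemma isClosed_setOf_inner_le (y : EuclideanSpace ℝ (Fin n)) (t : ℝ) :
    IsClosed {a : EuclideanSpace ℝ (Fin n) | inner ℝ a y ≤ t} :=
  isClosed_le (by fun_prop) continuous_const

lemma polarBody_eq_iInter :
    polarBody Ω x₀ = ⋂ x ∈ Ω, {a | inner ℝ a (x - x₀) ≤ 1} := by
  ext a; simp [polarBody]

lemma convex_polarBody : Convex ℝ (polarBody Ω x₀) := by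
  rw [polarBody_eq_iInter]
  exact convex_iInter₂ fun x _ => convex_setOf_inner_le _ _

lemma isCompact_polarBody (hopen : IsOpen Ω) (hx₀ : x₀ ∈ Ω) : IsCompact (polarBody Ω x₀) := by
  obtain ⟨r, hr, hball⟩ := Metric.isOpen_iff.1 hopen x₀ hx₀
  refine Metric.isCompact_of_isClosed_isBounded ?_ ?_
  · rw [polarBody_eq_iInter]
    exact isClosed_biInter fun x _ => isClosed_setOf_inner_le _ _
  · refine (Metric.isBounded_iff_subset_closedBall 0).2 ⟨2 / r, fun a ha => ?_⟩
    rw [mem_closedBall_zero_iff]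
    by_cases h0 : a = 0
    · rw [h0, norm_zero]; positivity
    have hn : 0 < ‖a‖ := norm_pos_iff.2 h0
    have hmem : x₀ + (r / (2 * ‖a‖)) • a ∈ Ω := by
      apply hball
      rw [mem_ball_iff_norm, add_sub_cancel_left, norm_smul, Real.norm_of_nonneg (by positivity)]
      have : r / (2 * ‖a‖) * ‖a‖ = r / 2 := by field_simp
      linarith
    have := ha _ hmem
    rw [add_sub_cancel_left, real_inner_smul_right, real_inner_self_eq_norm_sq] at this
    have h2 : r / (2 * ‖a‖) * ‖a‖ ^ 2 = r * ‖a‖ / 2 := by field_simp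
    rw [le_div_iff₀ hr]
    linarith

lemma zero_mem_polarBody : (0 : EuclideanSpace ℝ (Fin n)) ∈ polarBody Ω x₀ := by
  intro x _
  simp

/-- The bipolar theorem, with the constraints thinned out by the Krein-Milman theorem: the closure
of `Ω` is cut out by the extreme points of the polar body. -/
lemma mem_closure_iff_forall_extremePoints (hopen : IsOpen Ω) (hconv : Convex ℝ Ω) (hx₀ : x₀ ∈ Ω)
    (x : EuclideanSpace ℝ (Fin n)) :
    x ∈ closure Ω ↔ ∀ a ∈ (polarBody Ω x₀).extremePoints ℝ, inner ℝ a (x - x₀) ≤ 1 := by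
  constructor
  · intro hx a ha
    have hcl : IsClosed {y : EuclideanSpace ℝ (Fin n) | inner ℝ a (y - x₀) ≤ 1} :=
      isClosed_le (by fun_prop) continuous_const
    exact closure_minimal (fun y hy => ha.1 y hy) hcl hx
  · intro h
    by_contra hx
    obtain ⟨f, u, hfu, hux⟩ := geometric_hahn_banach_closed_point hconv.closure isClosed_closure hx
    set v := (InnerProductSpace.toDual ℝ (EuclideanSpace ℝ (Fin n))).symm f with hv
    have hfv : ∀ y, f y = inner ℝ v y := fun y => by
      rw [hv, InnerProductSpace.toDual_symm_apply]
    have hu0 : 0 < u - f x₀ := sub_pos.2 (hfu x₀ (subset_closure hx₀))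
    have hmem : (u - f x₀)⁻¹ • v ∈ polarBody Ω x₀ := by
      intro y hy
      rw [real_inner_smul_left, ← hfv, map_sub, inv_mul_le_iff₀ hu0]
      linarith [hfu y (subset_closure hy)]
    rw [← closure_convexHull_extremePoints (isCompact_polarBody hopen hx₀) convex_polarBody] at hmem
    have := closure_minimal (convexHull_min h (convex_setOf_inner_le (x - x₀) 1))
      (isClosed_setOf_inner_le _ _) hmem
    change inner ℝ _ (x - x₀) ≤ 1 at this
    rw [real_inner_smul_left, ← hfv, map_sub, inv_mul_le_iff₀ hu0] at this
    linarith

/-- Finitely many extreme points of the polar body would exhibit `closure Ω` as a polyhedron. -/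
lemma infinite_extremePoints_polarBody (hopen : IsOpen Ω) (hconv : Convex ℝ Ω) (hx₀ : x₀ ∈ Ω)
    (hpoly : ¬ IsPolyhedron (closure Ω)) :
    ((polarBody Ω x₀).extremePoints ℝ \ {0}).Infinite := by
  intro hfin
  refine hpoly ⟨(fun a => {x | inner ℝ a x ≤ 1 + inner ℝ a x₀}) ''
    ((polarBody Ω x₀).extremePoints ℝ \ {0}), hfin.image _, ?_, ?_⟩
  · rintro _ ⟨a, ha, rfl⟩
    exact ⟨a, _, ha.2, rfl⟩
  · ext x
    rw [mem_closure_iff_forall_extremePoints hopen hconv hx₀]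
    simp only [Set.sInter_image, Set.mem_iInter, Set.mem_ofPred_eq]
    constructor
    · intro h a ha
      have := h a ha.1
      rw [inner_sub_right] at this
      linarith
    · intro h a ha
      by_cases h0 : a = 0
      · simp [h0]
      · have := h a ⟨ha, h0⟩
        rw [inner_sub_right]
        linarith

/-- A nonzero extreme point of the polar body lies on its radial boundary: otherwise it would be
inside the segment from the origin to a multiple of it. -/
lemma le_one_of_smul_mem_polarBody {a : EuclideanSpace ℝ (Fin n)}
    (ha : a ∈ (polarBody Ω x₀).extremePoints ℝ \ {0}) {κ : ℝ} (hκ : κ • a ∈ polarBody Ω x₀) :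
    κ ≤ 1 := by
  by_contra! h
  have hmem : a ∈ openSegment ℝ 0 (κ • a) := by
    refine ⟨1 - κ⁻¹, κ⁻¹, sub_pos.2 (inv_lt_one_of_one_lt₀ h), by positivity, by ring, ?_⟩
    rw [smul_zero, zero_add, smul_smul, inv_mul_cancel₀ (by positivity), one_smul]
  exact ha.2 (((mem_extremePoints.1 ha.1).2 0 zero_mem_polarBody _ hκ hmem).1.symm)

/-- The constraint of a nonzero extreme point of the polar body is attained by `Ω` up to any
tolerance, so it cuts nonempty caps off `Ω`. -/
lemma exists_lt_inner_of_mem_extremePoints {a : EuclideanSpace ℝ (Fin n)}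
    (ha : a ∈ (polarBody Ω x₀).extremePoints ℝ \ {0}) {s : ℝ} (hs : s < 1) :
    ∃ x ∈ Ω, s < inner ℝ a (x - x₀) := by
  by_contra! h
  set t := max s (1 / 2) with ht
  have ht0 : 0 < t := lt_of_lt_of_le (by norm_num) (le_max_right _ _)
  have ht1 : t < 1 := max_lt hs (by norm_num)
  have hmem : t⁻¹ • a ∈ polarBody Ω x₀ := by
    intro x hx
    rw [real_inner_smul_left, inv_mul_le_iff₀ ht0, mul_one]
    exact (h x hx).trans (le_max_left _ _)
  exact absurd (le_one_of_smul_mem_polarBody ha hmem) (not_le.2 ((one_lt_inv₀ ht0).2 ht1))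

lemma eq_of_eq_smul_of_mem_extremePoints {a b : EuclideanSpace ℝ (Fin n)}
    (ha : a ∈ (polarBody Ω x₀).extremePoints ℝ \ {0})
    (hb : b ∈ (polarBody Ω x₀).extremePoints ℝ \ {0}) {κ : ℝ} (hκ : 0 < κ) (hab : a = κ • b) :
    a = b := by
  have h1 : κ ≤ 1 := le_one_of_smul_mem_polarBody hb (hab ▸ ha.1.1)
  have h2 : κ⁻¹ ≤ 1 := by
    refine le_one_of_smul_mem_polarBody ha ?_
    rw [hab, smul_smul, inv_mul_cancel₀ hκ.ne', one_smul]
    exact hb.1.1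
  have h3 : κ = 1 := le_antisymm h1 (by rwa [inv_le_one₀ hκ] at h2)
  rw [hab, h3, one_smul]

/-- If an extreme point `m` of the polar body lies in the open cone spanned by two further points
`a`, `c` of it, then it lies strictly beyond the segment from `a` to `c`. -/
lemma one_lt_add_of_mem_extremePoints {a m c : EuclideanSpace ℝ (Fin n)}
    (ha : a ∈ polarBody Ω x₀) (hm : m ∈ (polarBody Ω x₀).extremePoints ℝ \ {0})
    (hc : c ∈ polarBody Ω x₀) (ham : a ≠ m) {α γ : ℝ} (hα : 0 < α) (hγ : 0 < γ)
    (h : m = α • a + γ • c) : 1 < α + γ := by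
  have hs : 0 < α + γ := by positivity
  have hseg : (α + γ)⁻¹ • m ∈ openSegment ℝ a c := by
    refine ⟨α / (α + γ), γ / (α + γ), by positivity, by positivity, by field_simp, ?_⟩
    rw [h, smul_add, smul_smul, smul_smul, inv_mul_eq_div, inv_mul_eq_div]
  have hmem : (α + γ)⁻¹ • m ∈ polarBody Ω x₀ :=
    convex_polarBody.segment_subset ha hc (openSegment_subset_segment _ _ _ hseg)
  have h1 := le_one_of_smul_mem_polarBody hm hmem
  rw [inv_le_one₀ hs] at h1
  refine lt_of_le_of_ne h1 fun h2 => ham ?_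
  rw [← h2, inv_one, one_smul] at hseg
  exact ((mem_extremePoints.1 hm.1).2 a ha c hc hseg).1

end Polar

section Plane

variable {Ω : Set (EuclideanSpace ℝ (Fin 2))} {x₀ : EuclideanSpace ℝ (Fin 2)}

/-- If the plane vectors `a`, `b`, `c` lie on the same side of the vertical axis and the slope of
`b` is strictly between those of `a` and `c`, then `b` is in the open cone spanned by `a`
and `c`. -/
lemma exists_pos_combination_of_slope {a b c : EuclideanSpace ℝ (Fin 2)}
    (hab : 0 < a 0 * b 0) (hbc : 0 < b 0 * c 0) (h1 : a 1 / a 0 < b 1 / b 0)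
    (h2 : b 1 / b 0 < c 1 / c 0) :
    ∃ α γ : ℝ, 0 < α ∧ 0 < γ ∧ b = α • a + γ • c := by
  have ha0 : a 0 ≠ 0 := left_ne_zero_of_mul hab.ne'
  have hb0 : b 0 ≠ 0 := left_ne_zero_of_mul hbc.ne'
  have hc0 : c 0 ≠ 0 := right_ne_zero_of_mul hbc.ne'
  set p := a 1 / a 0 with hp
  set q := b 1 / b 0 with hq
  set r := c 1 / c 0 with hr
  have ha1 : a 1 = p * a 0 := by rw [hp]; field_simp
  have hb1 : b 1 = q * b 0 := by rw [hq]; field_simp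
  have hc1 : c 1 = r * c 0 := by rw [hr]; field_simp
  have hpr : 0 < r - p := by linarith
  have hba : 0 < b 0 / a 0 := by
    rw [div_eq_mul_inv]
    have : b 0 * (a 0)⁻¹ = (a 0 * b 0) * ((a 0)⁻¹) ^ 2 := by field_simp
    rw [this]; positivity
  have hbc' : 0 < b 0 / c 0 := by
    have : b 0 / c 0 = (b 0 * c 0) * ((c 0)⁻¹) ^ 2 := by field_simp
    rw [this]; positivity
  refine ⟨b 0 / a 0 * ((r - q) / (r - p)), b 0 / c 0 * ((q - p) / (r - p)),
    mul_pos hba (div_pos (by linarith) hpr), mul_pos hbc' (div_pos (by linarith) hpr), ?_⟩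
  ext i
  fin_cases i
  · simp only [Fin.zero_eta, PiLp.add_apply, PiLp.smul_apply, smul_eq_mul]
    field_simp
    ring
  · simp only [Fin.mk_one, PiLp.add_apply, PiLp.smul_apply, smul_eq_mul, ha1, hb1, hc1]
    field_simp
    ring

/-- Infinitely many extreme points of a planar polar body contain a sequence that runs
monotonically through the directions of an open half-plane. -/
lemma exists_angular_sequence (hinf : ((polarBody Ω x₀).extremePoints ℝ \ {0}).Infinite) :
    ∃ b : ℕ → EuclideanSpace ℝ (Fin 2), Function.Injective b ∧
      (∀ i, b i ∈ (polarBody Ω x₀).extremePoints ℝ \ {0}) ∧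
      (∀ i j, 0 < b i 0 * b j 0) ∧
      ∀ i j k, i < j → j < k → ∃ α γ : ℝ, 0 < α ∧ 0 < γ ∧ b j = α • b i + γ • b k := by
  set S := (polarBody Ω x₀).extremePoints ℝ \ {0} with hS
  -- Each of the two vertical rays contains at most one point of `S`.
  have hvert : (S ∩ {a | a 0 = 0}).Finite := by
    have hsub : ∀ ε : ℝ, (S ∩ {a | a 0 = 0 ∧ 0 < ε * a 1}).Subsingleton := by
      rintro ε a ⟨haS, ha0, ha1⟩ b ⟨hbS, hb0, hb1⟩
      have hb1' : b 1 ≠ 0 := right_ne_zero_of_mul hb1.ne'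
      have hε : ε ≠ 0 := left_ne_zero_of_mul hb1.ne'
      refine eq_of_eq_smul_of_mem_extremePoints haS hbS (κ := a 1 / b 1) ?_ ?_
      · rw [← mul_div_mul_left _ _ hε]; positivity
      · ext i
        fin_cases i
        · simp [ha0, hb0]
        · simp [hb1']
    refine ((hsub 1).finite.union (hsub (-1)).finite).subset ?_
    rintro a ⟨haS, ha0⟩
    have ha0' : a 0 = 0 := ha0
    rcases lt_trichotomy (a 1) 0 with h | h | h
    · exact Or.inr ⟨haS, ha0', by linarith⟩
    · refine absurd ?_ haS.2
      ext i
      fin_cases i <;> simp [ha0', h]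
    · exact Or.inl ⟨haS, ha0', by linarith⟩
  have hside : ∃ ε : ℝ, (S ∩ {a | 0 < ε * a 0}).Infinite := by
    by_contra! h
    have h1 := h 1
    have h2 := h (-1)
    refine hinf (((h1.union h2).union hvert).subset fun a ha => ?_)
    rcases lt_trichotomy (a 0) 0 with h | h | h
    · exact Or.inl (Or.inr ⟨ha, by simpa using h⟩)
    · exact Or.inr ⟨ha, h⟩
    · exact Or.inl (Or.inl ⟨ha, by simpa using h⟩)
  obtain ⟨ε, hε⟩ := hside
  set f : ℕ → EuclideanSpace ℝ (Fin 2) := fun i => (hε.natEmbedding _ i : EuclideanSpace ℝ (Fin 2))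
  have hfinj : Function.Injective f :=
    Subtype.val_injective.comp (hε.natEmbedding _).injective
  have hfS : ∀ i, f i ∈ S := fun i => (hε.natEmbedding _ i).2.1
  have hf0 : ∀ i, 0 < ε * f i 0 := fun i => (hε.natEmbedding _ i).2.2
  have hsame : ∀ i j, 0 < f i 0 * f j 0 := by
    intro i j
    have h1 := mul_pos (hf0 i) (hf0 j)
    have h2 : ε * f i 0 * (ε * f j 0) = ε ^ 2 * (f i 0 * f j 0) := by ring
    rw [h2] at h1
    exact pos_of_mul_pos_right h1 (sq_nonneg _)
  have hslope : ∀ i j, f i 1 / f i 0 = f j 1 / f j 0 → i = j := by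
    intro i j h
    have hi0 : f i 0 ≠ 0 := right_ne_zero_of_mul (hf0 i).ne'
    have hj0 : f j 0 ≠ 0 := right_ne_zero_of_mul (hf0 j).ne'
    apply hfinj
    refine eq_of_eq_smul_of_mem_extremePoints (hfS i) (hfS j) (κ := f i 0 / f j 0) ?_ ?_
    · have : f i 0 / f j 0 = (f i 0 * f j 0) * ((f j 0)⁻¹) ^ 2 := by field_simp
      rw [this]
      have := hsame i j
      positivity
    · ext l
      fin_cases l
      · simp [hj0]
      · simp only [Fin.mk_one, PiLp.smul_apply, smul_eq_mul]
        field_simp at h ⊢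
        linarith
  obtain ⟨g, hg⟩ := exists_increasing_or_nonincreasing_subseq (· < ·) fun i => f i 1 / f i 0
  refine ⟨f ∘ g, hfinj.comp g.injective, fun i => hfS _, fun i j => hsame _ _, ?_⟩
  intro i j k hij hjk
  rcases hg with hg | hg
  · exact exists_pos_combination_of_slope (hsame _ _) (hsame _ _) (hg i j hij) (hg j k hjk)
  · have hlt : ∀ m n, m < n → f (g n) 1 / f (g n) 0 < f (g m) 1 / f (g m) 0 := fun m n hmn =>
      lt_of_le_of_ne (not_lt.1 (hg m n hmn)) fun h => hmn.ne' (g.injective (hslope _ _ h))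
    obtain ⟨α, γ, hα, hγ, h⟩ := exists_pos_combination_of_slope (hsame (g k) (g j))
      (hsame (g j) (g i)) (hlt j k hjk) (hlt i j hij)
    exact ⟨γ, α, hγ, hα, by rw [add_comm]; exact h⟩

/-- The cap cut off in the direction `b (2 * i)` is, once thin enough, disjoint from thin caps in
all the later directions `b (2 * j)`. -/
lemma exists_disjoint_cap {b : ℕ → EuclideanSpace ℝ (Fin 2)} (hinj : Function.Injective b)
    (hb : ∀ i, b i ∈ (polarBody Ω x₀).extremePoints ℝ \ {0}) (hsame : ∀ i j, 0 < b i 0 * b j 0)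
    (hcone : ∀ i j k, i < j → j < k → ∃ α γ : ℝ, 0 < α ∧ 0 < γ ∧ b j = α • b i + γ • b k)
    (i : ℕ) :
    ∃ s < (1 : ℝ), ∀ j, i < j → ∃ t < (1 : ℝ), ∀ x ∈ Ω,
      s < inner ℝ (b (2 * i)) (x - x₀) → inner ℝ (b (2 * j)) (x - x₀) ≤ t := by
  obtain ⟨α, γ, hα, hγ, hm⟩ := hcone (2 * i) (2 * i + 1) (2 * i + 2) (by lia) (by lia)
  have hαγ : 1 < α + γ := one_lt_add_of_mem_extremePoints (hb _).1.1 (hb _) (hb _).1.1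
    (hinj.ne (by lia)) hα hγ hm
  set a := b (2 * i) with ha
  set m := b (2 * i + 1)
  set c := b (2 * i + 2) with hc
  -- The middle point `m = α • a + γ • c` has `α + γ > 1`, so its constraint keeps
  -- `⟪c, x - x₀⟫` away from `1` when `⟪a, x - x₀⟫` is near `1`; the gap is `K * θ` for a cap
  -- of height `θ`.
  -- `K` bounds the coefficient of `a` when `c` is a positive combination of `a` and a later `b j`.
  set K := (c 0 * a 0) / (a 0 * a 0) with hKdef
  have hK : 0 < K := div_pos (hsame _ _) (hsame _ _)
  set θ := (α + γ - 1) / γ / (K + α / γ) with hθdef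
  have hθ : 0 < θ := div_pos (div_pos (by linarith) hγ) (by positivity)
  have hθeq : θ * (K * γ + α) = α + γ - 1 := by
    rw [hθdef]
    field_simp
  have hcx : ∀ x ∈ Ω, 1 - θ < inner ℝ a (x - x₀) → inner ℝ c (x - x₀) < 1 - K * θ := by
    intro x hx hs
    have h1 := (hb (2 * i + 1)).1.1 x hx
    change inner ℝ m (x - x₀) ≤ 1 at h1
    rw [hm, inner_add_left, real_inner_smul_left, real_inner_smul_left] at h1
    have h2 := mul_lt_mul_of_pos_left hs hα
    by_contra! h3
    have h4 := mul_le_mul_of_nonneg_left h3 hγ.le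
    nlinarith
  refine ⟨1 - θ, by linarith, fun j hij => ?_⟩
  rcases Nat.lt_or_ge (i + 1) j with hj | hj
  · obtain ⟨α', γ', hα', hγ', h'⟩ := hcone (2 * i) (2 * i + 2) (2 * j) (by lia) (by lia)
    have hαγ' : 1 < α' + γ' := one_lt_add_of_mem_extremePoints (hb _).1.1 (hb _) (hb _).1.1
      (hinj.ne (by lia)) hα' hγ' h'
    have hα'K : α' ≤ K := by
      rw [hKdef, le_div_iff₀ (hsame _ _)]
      have h0 : c 0 = α' * a 0 + γ' * b (2 * j) 0 := by
        have := congrArg (fun v : EuclideanSpace ℝ (Fin 2) => v 0) h'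
        simpa using this
      rw [h0]
      have := mul_pos hγ' (hsame (2 * j) (2 * i))
      rw [← ha] at this
      nlinarith
    refine ⟨(1 - K * θ - α' * (1 - θ)) / γ', ?_, fun x hx hs => ?_⟩
    · rw [div_lt_one hγ']
      nlinarith
    · have h1 := hcx x hx hs
      rw [hc, h', inner_add_left, real_inner_smul_left, real_inner_smul_left] at h1
      have h2 := mul_lt_mul_of_pos_left hs hα'
      rw [le_div_iff₀ hγ']
      nlinarith
  · have hj' : 2 * j = 2 * i + 2 := by lia
    refine ⟨1 - K * θ, by nlinarith, fun x hx hs => ?_⟩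
    rw [hj']
    exact (hcx x hx hs).le

/-- A planar convex open set whose closure is not a polyhedron has infinitely many pairwise disjoint
caps. The ball of radius `2 * δ i` around `2 • c i` lies in `2 • Ω`, and a sum of two points of `Ω`
can be within `3 * δ i` of `2 • c i` only if both points are in the cap `C i`. -/
lemma exists_disjoint_caps (hne : Ω.Nonempty) (hopen : IsOpen Ω) (hconv : Convex ℝ Ω)
    (hpoly : ¬ IsPolyhedron (closure Ω)) :
    ∃ (C : ℕ → Set (EuclideanSpace ℝ (Fin 2))) (c : ℕ → EuclideanSpace ℝ (Fin 2)) (δ : ℕ → ℝ),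
      (∀ i, IsOpen (C i)) ∧ Pairwise (Function.onFun Disjoint C) ∧ (∀ i, 0 < δ i) ∧
      (∀ i, Metric.ball (c i) (δ i) ⊆ Ω) ∧
      ∀ i, ∀ x ∈ Ω, ∀ y ∈ Ω, x + y ∈ Metric.ball ((2 : ℝ) • c i) (3 * δ i) → x ∈ C i := by
  obtain ⟨x₀, hx₀⟩ := hne
  obtain ⟨b, hinj, hb, hsame, hcone⟩ :=
    exists_angular_sequence (infinite_extremePoints_polarBody hopen hconv hx₀ hpoly)
  choose s hs t ht hst using exists_disjoint_cap hinj hb hsame hcone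
  have hr : ∀ j, ∃ r < (1 : ℝ), s j ≤ r ∧ ∀ i (hij : i < j), t i j hij ≤ r := by
    intro j
    have hfin : (insert (s j) (Set.range fun i : Fin j => t i j i.2)).Finite :=
      (Set.finite_range _).insert _
    have hne : (insert (s j) (Set.range fun i : Fin j => t i j i.2)).Nonempty :=
      Set.insert_nonempty _ _
    obtain ⟨r, hrmem, hrmax⟩ := hfin.exists_maximal hne
    have hmax : ∀ u ∈ insert (s j) (Set.range fun i : Fin j => t i j i.2), u ≤ r := fun u hu =>
      (le_total u r).elim id fun h => hrmax hu h
    refine ⟨r, ?_, hmax _ (Set.mem_insert _ _), fun i hij => hmax _ (Or.inr ⟨⟨i, hij⟩, rfl⟩)⟩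
    rcases hrmem with rfl | ⟨i, rfl⟩
    · exact hs j
    · exact ht _ _ _
  choose r hr1 hsr htr using hr
  have hc : ∀ j, ∃ x ∈ Ω, (1 + r j) / 2 < inner ℝ (b (2 * j)) (x - x₀) := fun j =>
    exists_lt_inner_of_mem_extremePoints (hb _) (by linarith [hr1 j])
  choose c hcΩ hcr using hc
  have hδ : ∀ j, ∃ δ > 0, Metric.ball (c j) δ ⊆ Ω ∧
      3 * δ * ‖b (2 * j)‖ ≤ 2 * inner ℝ (b (2 * j)) (c j - x₀) - (1 + r j) := by
    intro j
    obtain ⟨ρ, hρ, hball⟩ := Metric.isOpen_iff.1 hopen (c j) (hcΩ j)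
    have hb0 : 0 < ‖b (2 * j)‖ := norm_pos_iff.2 (hb (2 * j)).2
    have hgap : 0 < 2 * inner ℝ (b (2 * j)) (c j - x₀) - (1 + r j) := by linarith [hcr j]
    refine ⟨min ρ ((2 * inner ℝ (b (2 * j)) (c j - x₀) - (1 + r j)) / (3 * ‖b (2 * j)‖)),
      lt_min hρ (by positivity), (Metric.ball_subset_ball (min_le_left _ _)).trans hball, ?_⟩
    calc _ ≤ 3 * ((2 * inner ℝ (b (2 * j)) (c j - x₀) - (1 + r j)) / (3 * ‖b (2 * j)‖)) *
          ‖b (2 * j)‖ := by gcongr; exact min_le_right _ _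
      _ = _ := by field_simp
  choose δ hδ0 hδball hδgap using hδ
  refine ⟨fun j => {x | x ∈ Ω ∧ r j < inner ℝ (b (2 * j)) (x - x₀)}, c, δ, ?_, ?_, hδ0, hδball, ?_⟩
  · intro j
    have hcont : Continuous fun x => inner ℝ (b (2 * j)) (x - x₀) := by fun_prop
    exact hopen.inter (isOpen_lt continuous_const hcont)
  · have key : ∀ i j, i < j → Disjoint {x | x ∈ Ω ∧ r i < inner ℝ (b (2 * i)) (x - x₀)}
        {x | x ∈ Ω ∧ r j < inner ℝ (b (2 * j)) (x - x₀)} := by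
      intro i j hij
      rw [Set.disjoint_left]
      rintro x ⟨hx, hxi⟩ ⟨_, hxj⟩
      have := hst i j hij x hx ((hsr i).trans_lt hxi)
      linarith [htr j i hij]
    intro i j hij
    rcases lt_or_gt_of_ne hij with h | h
    · exact key i j h
    · exact (key j i h).symm
  · intro j x hx y hy hxy
    refine ⟨hx, ?_⟩
    have hy1 := (hb (2 * j)).1.1 y hy
    have h1 : inner ℝ (b (2 * j)) ((2 : ℝ) • c j - (x + y)) ≤
        ‖b (2 * j)‖ * ‖(2 : ℝ) • c j - (x + y)‖ :=
      real_inner_le_norm _ _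
    have h2 : ‖(2 : ℝ) • c j - (x + y)‖ < 3 * δ j := by
      rw [← dist_eq_norm, dist_comm]; exact hxy
    have h3 : ‖b (2 * j)‖ * ‖(2 : ℝ) • c j - (x + y)‖ < 3 * δ j * ‖b (2 * j)‖ := by
      rw [mul_comm]
      exact mul_lt_mul_of_pos_right h2 (norm_pos_iff.2 (hb (2 * j)).2)
    have h4 := hδgap j
    simp only [inner_sub_right, inner_add_right, real_inner_smul_right] at h1 h4 hy1 ⊢
    linarith

end Plane

/-! ### Tempered distributions and translations -/

section Tempered

variable {n : ℕ}

/-- Schwartz functions that are dominated by the summable sequence `2⁻ᵏ (1 + ‖ξ‖ ^ 2)` of functions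
of polynomial growth sum to a tempered distribution. -/
lemma exists_temperedDistribution_hasSum (φ : ℕ → 𝓢(EuclideanSpace ℝ (Fin n), ℂ))
    (hφ : ∀ k ξ, ‖φ k ξ‖ ≤ (1 / 2) ^ k * (1 + ‖ξ‖ ^ 2)) :
    ∃ Φ : 𝓢'(EuclideanSpace ℝ (Fin n), ℂ),
      ∀ g : 𝓢(EuclideanSpace ℝ (Fin n), ℂ), HasSum (fun k => ∫ ξ, φ k ξ * g ξ) (Φ g) := by
  set w : EuclideanSpace ℝ (Fin n) → ℂ := fun ξ => ((1 + ‖ξ‖ ^ 2 : ℝ) : ℂ) with hw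
  have hwt : w.HasTemperateGrowth := by
    rw [hw]
    fun_prop
  have hw0 : ∀ ξ, w ξ ≠ 0 := fun ξ => by
    rw [hw]
    exact Complex.ofReal_ne_zero.2 (by positivity)
  have hwn : ∀ ξ, ‖w ξ‖ = 1 + ‖ξ‖ ^ 2 := fun ξ => by
    rw [hw, Complex.norm_real, Real.norm_of_nonneg (by positivity)]
  have hbound : ∀ k ξ, ‖φ k ξ / w ξ‖ ≤ (1 / 2) ^ k := fun k ξ => by
    rw [norm_div, hwn, div_le_iff₀ (by positivity)]
    exact hφ k ξ
  have hmem : ∀ k, MemLp (fun ξ => φ k ξ / w ξ) ∞ (volume : Measure (EuclideanSpace ℝ (Fin n))) :=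
    fun k => memLp_top_of_bound
      ((φ k).continuous.div hwt.1.continuous hw0).aestronglyMeasurable _ (ae_of_all _ (hbound k))
  have hsum : Summable fun k => (hmem k).toLp := by
    refine Summable.of_norm_bounded summable_geometric_two fun k => ?_
    rw [Lp.norm_toLp]
    refine ENNReal.toReal_le_of_le_ofReal (by positivity) ?_
    rw [eLpNorm_exponent_top]
    exact eLpNormEssSup_le_of_ae_bound (ae_of_all _ (hbound k))
  refine ⟨TemperedDistribution.smulLeftCLM ℂ w (∑' k, (hmem k).toLp : Lp ℂ ∞ volume), fun g => ?_⟩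
  set L : Lp ℂ ∞ (volume : Measure (EuclideanSpace ℝ (Fin n))) →L[ℂ] ℂ :=
    (PointwiseConvergenceCLM.evalCLM (RingHom.id ℂ) ℂ (smulLeftCLM ℂ w g)).comp
      (Lp.toTemperedDistributionCLM ℂ volume ∞) with hL
  have h := hsum.hasSum.mapL L
  have h1 : ∀ f, L f = Lp.toTemperedDistribution f (smulLeftCLM ℂ w g) := fun f => rfl
  rw [TemperedDistribution.smulLeftCLM_apply_apply, ← h1]
  convert h using 2 with k
  rw [h1, Lp.toTemperedDistribution_apply]
  refine integral_congr_ae ?_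
  filter_upwards [(hmem k).coeFn_toLp] with ξ hξ
  rw [hξ, smulLeftCLM_apply_apply hwt, smul_eq_mul, smul_eq_mul]
  field_simp [hw0 ξ]

/-- Far translates of a Schwartz function are small relative to `1 + ‖ξ‖ ^ 2`, since they are large
only where this weight is. -/
lemma exists_translate_norm_le [Nontrivial (EuclideanSpace ℝ (Fin n))]
    (u : 𝓢(EuclideanSpace ℝ (Fin n), ℂ)) {ε : ℝ} (hε : 0 < ε) :
    ∃ τ : EuclideanSpace ℝ (Fin n), ∀ ξ, ‖u (ξ - τ)‖ ≤ ε * (1 + ‖ξ‖ ^ 2) := by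
  obtain ⟨C₀, h0, hC0⟩ := u.decay 0 0
  obtain ⟨C₂, h2, hC2⟩ := u.decay 2 0
  obtain ⟨τ, hτ⟩ := NormedSpace.exists_lt_norm ℝ (EuclideanSpace ℝ (Fin n))
    (1 + (C₀ + C₂) / ε)
  refine ⟨τ, fun ξ => ?_⟩
  have hC : 0 < C₀ + C₂ := by positivity
  have hu : (1 + ‖ξ - τ‖ ^ 2) * ‖u (ξ - τ)‖ ≤ C₀ + C₂ := by
    have h3 := hC0 (ξ - τ)
    have h4 := hC2 (ξ - τ)
    simp only [norm_iteratedFDeriv_zero, pow_zero, one_mul] at h3 h4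
    linarith
  have htri : ‖τ‖ ≤ ‖ξ‖ + ‖ξ - τ‖ := by
    have := norm_sub_le ξ (ξ - τ)
    rwa [sub_sub_cancel] at this
  have h1τ : 1 ≤ ‖τ‖ := by
    have : 0 < (C₀ + C₂) / ε := by positivity
    linarith
  have hlarge : (C₀ + C₂) ≤ ε * ‖τ‖ ^ 2 := by
    have h5 : (C₀ + C₂) / ε ≤ ‖τ‖ ^ 2 := by nlinarith
    rwa [div_le_iff₀' hε] at h5
  -- `(1 + a ^ 2) * (1 + b ^ 2) = (a + b) ^ 2 + (1 - a * b) ^ 2`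
  have hprod : ‖τ‖ ^ 2 ≤ (1 + ‖ξ‖ ^ 2) * (1 + ‖ξ - τ‖ ^ 2) := by
    have h6 : ‖τ‖ ^ 2 ≤ (‖ξ‖ + ‖ξ - τ‖) ^ 2 := by gcongr
    nlinarith [sq_nonneg (1 - ‖ξ‖ * ‖ξ - τ‖)]
  have hpos : 0 < 1 + ‖ξ - τ‖ ^ 2 := by positivity
  refine le_of_mul_le_mul_left (hu.trans (hlarge.trans ?_)) hpos
  calc ε * ‖τ‖ ^ 2 ≤ ε * ((1 + ‖ξ‖ ^ 2) * (1 + ‖ξ - τ‖ ^ 2)) := by gcongr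
    _ = _ := by ring

/-- Translations become modulations on the Fourier side, which do not change absolute values. -/
lemma norm_fourier_compSubConstCLM (τ x : EuclideanSpace ℝ (Fin n))
    (f : 𝓢(EuclideanSpace ℝ (Fin n), ℂ)) : ‖𝓕 (compSubConstCLM ℂ τ f) x‖ = ‖𝓕 f x‖ := by
  have h := congrFun (VectorFourier.fourierIntegral_comp_add_right Real.fourierChar volume
    (innerₗ (EuclideanSpace ℝ (Fin n))) f (-τ)) x
  have h1 : 𝓕 (compSubConstCLM ℂ τ f) x = VectorFourier.fourierIntegral Real.fourierChar volume
    (innerₗ (EuclideanSpace ℝ (Fin n)))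
      ((f : EuclideanSpace ℝ (Fin n) → ℂ) ∘ fun v => v + -τ) x := by
    rw [fourier_coe]
    congr 1
  rw [h1, h, Circle.norm_smul]
  rfl

lemma norm_fourierInv_compSubConstCLM (τ x : EuclideanSpace ℝ (Fin n))
    (f : 𝓢(EuclideanSpace ℝ (Fin n), ℂ)) : ‖𝓕⁻ (compSubConstCLM ℂ τ f) x‖ = ‖𝓕⁻ f x‖ := by
  have h : ∀ g : 𝓢(EuclideanSpace ℝ (Fin n), ℂ), 𝓕⁻ g x = 𝓕 g (-x) := fun g => by
    rw [fourierInv_coe, fourier_coe, Real.fourierInv_eq_fourier_neg]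
  rw [h, h, norm_fourier_compSubConstCLM]

end Tempered

/-! ### Block diagonal Hankel operators -/

section BlockOperator

variable {n : ℕ}

/-- The Cauchy-Schwarz inequality against the constant function `1`. -/
lemma sq_setLIntegral_le {X : Type*} [MeasurableSpace X] (μ : Measure X) {T : Set X}
    {F : X → ℝ≥0∞} (hF : AEMeasurable F (μ.restrict T)) :
    (∫⁻ y in T, F y ∂μ) ^ 2 ≤ μ T * ∫⁻ y in T, F y ^ 2 ∂μ := by
  have h := ENNReal.lintegral_mul_le_Lp_mul_Lq (μ.restrict T) Real.HolderConjugate.two_two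
    (aemeasurable_const (b := (1 : ℝ≥0∞))) hF
  simp only [Pi.mul_apply, one_mul, one_pow, lintegral_const, Measure.restrict_apply,
    MeasurableSet.univ, Set.univ_inter, ENNReal.rpow_two] at h
  calc (∫⁻ y in T, F y ∂μ) ^ 2
      ≤ (μ T ^ (1 / (2 : ℝ)) * (∫⁻ y in T, F y ^ 2 ∂μ) ^ (1 / (2 : ℝ))) ^ 2 := by gcongr
    _ = _ := by
      rw [mul_pow, ← ENNReal.rpow_natCast, ← ENNReal.rpow_natCast, ← ENNReal.rpow_mul,
        ← ENNReal.rpow_mul]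
      norm_num

/-- A kernel `K (x + y)` on `Ω × Ω` that is carried by the products `C p × C p` of pairwise disjoint
sets defines a block diagonal operator. By the Cauchy-Schwarz inequality it is bounded on `L²` as
soon as its blocks are dominated by `A p` times the indicator function of `x + y ∈ B p`, with
uniformly bounded products `A p * volume (B p)`.
Here `G` is the image of `F`, and `hG` says that `G x` involves the block of `x` only. -/
lemma lintegral_sq_le_of_blocks {Ω : Set (EuclideanSpace ℝ (Fin n))} (hΩ : MeasurableSet Ω)
    {ι : Type*} [Countable ι]
    {C B : ι → Set (EuclideanSpace ℝ (Fin n))} (hC : ∀ p, MeasurableSet (C p))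
    (hdisj : Pairwise (Function.onFun Disjoint C)) (hB : ∀ p, MeasurableSet (B p))
    {A : ι → ℝ≥0∞} {M : ℝ≥0∞} (hAM : ∀ p, A p * volume (B p) ≤ M)
    {F G : EuclideanSpace ℝ (Fin n) → ℝ≥0∞} (hF : Measurable F)
    (hG0 : ∀ x ∈ Ω, (∀ p, x ∉ C p) → G x = 0)
    (hG : ∀ x ∈ Ω, ∀ p, x ∈ C p → G x ≤ A p * ∫⁻ y in C p ∩ {y | x + y ∈ B p}, F y) :
    ∫⁻ x in Ω, G x ^ 2 ≤ M ^ 2 * ∫⁻ y, F y ^ 2 := by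
  have hBs : ∀ p x, MeasurableSet {y | x + y ∈ B p} := fun p x =>
    (measurable_const_add x) (hB p)
  have hvol : ∀ p x, volume {y | x + y ∈ B p} = volume (B p) := fun p x =>
    measure_preimage_add volume x (B p)
  have hvol' : ∀ p y, volume {x | x + y ∈ B p} = volume (B p) := fun p y =>
    measure_preimage_add_right volume y (B p)
  have hpt : ∀ x ∈ Ω, G x ^ 2 ≤
      ∑' p, M * A p * ∫⁻ y in C p, ({y | x + y ∈ B p}.indicator (fun y => F y ^ 2) y) := by
    intro x hx
    by_cases h : ∃ p, x ∈ C p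
    · obtain ⟨p, hp⟩ := h
      refine le_trans ?_ (ENNReal.le_tsum p)
      rw [setLIntegral_indicator (hBs p x), Set.inter_comm]
      calc G x ^ 2 ≤ (A p * ∫⁻ y in C p ∩ {y | x + y ∈ B p}, F y) ^ 2 := by
            gcongr; exact hG x hx p hp
        _ ≤ A p ^ 2 * (volume (C p ∩ {y | x + y ∈ B p}) *
              ∫⁻ y in C p ∩ {y | x + y ∈ B p}, F y ^ 2) := by
            rw [mul_pow]
            gcongr
            exact sq_setLIntegral_le _ hF.aemeasurable
        _ ≤ A p ^ 2 * (volume (B p) * ∫⁻ y in C p ∩ {y | x + y ∈ B p}, F y ^ 2) := by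
            gcongr A p ^ 2 * (?_ * _)
            exact (measure_mono Set.inter_subset_right).trans_eq (hvol p x)
        _ = A p * volume (B p) * A p * ∫⁻ y in C p ∩ {y | x + y ∈ B p}, F y ^ 2 := by ring
        _ ≤ _ := by gcongr; exact hAM p
    · rw [hG0 x hx (not_exists.1 h), zero_pow two_ne_zero]
      exact zero_le
  have hjoint : ∀ p, Measurable fun z : EuclideanSpace ℝ (Fin n) × EuclideanSpace ℝ (Fin n) =>
      {y | z.1 + y ∈ B p}.indicator (fun y => F y ^ 2) z.2 := by
    intro p
    have : (fun z : EuclideanSpace ℝ (Fin n) × EuclideanSpace ℝ (Fin n) =>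
        {y | z.1 + y ∈ B p}.indicator (fun y => F y ^ 2) z.2) =
        {z | z.1 + z.2 ∈ B p}.indicator fun z => F z.2 ^ 2 := by
      ext z; simp [Set.indicator]
    rw [this]
    exact ((hF.comp measurable_snd).pow_const 2).indicator
      ((measurable_fst.add measurable_snd) (hB p))
  calc ∫⁻ x in Ω, G x ^ 2
      ≤ ∫⁻ x in Ω, ∑' p, M * A p *
          ∫⁻ y in C p, ({y | x + y ∈ B p}.indicator (fun y => F y ^ 2) y) := by
        exact setLIntegral_mono' hΩ hpt
    _ ≤ ∫⁻ x, ∑' p, M * A p *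
          ∫⁻ y in C p, ({y | x + y ∈ B p}.indicator (fun y => F y ^ 2) y) :=
        setLIntegral_le_lintegral _ _
    _ = ∑' p, M * A p * ∫⁻ x, ∫⁻ y in C p, ({y | x + y ∈ B p}.indicator (fun y => F y ^ 2) y) := by
        have hm : ∀ p, Measurable fun x =>
            ∫⁻ y in C p, ({y | x + y ∈ B p}.indicator (fun y => F y ^ 2) y) := fun p =>
          (hjoint p).lintegral_prod_right'
        rw [lintegral_tsum fun p => ((hm p).const_mul _).aemeasurable]
        congr 1 with p
        rw [lintegral_const_mul _ (hm p)]
    _ = ∑' p, M * (A p * volume (B p)) * ∫⁻ y in C p, F y ^ 2 := by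
        congr 1 with p
        rw [lintegral_lintegral_swap (hjoint p).aemeasurable]
        have : ∀ y, ∫⁻ x, ({y | x + y ∈ B p}.indicator (fun y => F y ^ 2) y) =
            volume (B p) * F y ^ 2 := by
          intro y
          have h1 : ∀ x, ({y | x + y ∈ B p}.indicator (fun y => F y ^ 2) y) =
              {x | x + y ∈ B p}.indicator (fun _ => F y ^ 2) x := fun x => by
            simp [Set.indicator]
          have h2 : MeasurableSet {x | x + y ∈ B p} := (measurable_add_const y) (hB p)
          simp_rw [h1]
          rw [lintegral_indicator_const h2, hvol', mul_comm]
        simp_rw [this]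
        rw [lintegral_const_mul _ (hF.pow_const 2)]
        ring
    _ ≤ ∑' p, M * M * ∫⁻ y in C p, F y ^ 2 := by
        gcongr with p
        exact hAM p
    _ = M ^ 2 * ∫⁻ y in ⋃ p, C p, F y ^ 2 := by
        rw [ENNReal.tsum_mul_left, lintegral_iUnion hC hdisj, sq]
    _ ≤ _ := by
        gcongr
        exact Measure.restrict_le_self

/-- If the Fourier transforms `U k` of the summands of a symbol are carried by balls of which each
sees only one of countably many disjoint caps of `Ω`, the Hankel operator is block diagonal, and
bounded when the blocks are uniformly bounded. -/
lemma generatesBoundedHankel_of_blocks {Ω : Set (EuclideanSpace ℝ (Fin n))} (hΩ : MeasurableSet Ω)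
    {C B : ℕ × ℕ → Set (EuclideanSpace ℝ (Fin n))} (hC : ∀ p, MeasurableSet (C p))
    (hdisj : Pairwise (Function.onFun Disjoint C)) (hB : ∀ p, MeasurableSet (B p))
    (hBC : ∀ p, ∀ x ∈ Ω, ∀ y ∈ Ω, x + y ∈ B p → x ∈ C p)
    {U : ℕ → 𝓢(EuclideanSpace ℝ (Fin n), ℂ)}
    (hsupp : ∀ k z, U k z ≠ 0 → ∃ i, z ∈ B (k, i))
    {A : ℕ → ℝ≥0∞} (hA : ∀ k, ∀ x ∈ Ω, ∀ y ∈ Ω, ‖U k (x + y)‖ₑ ≤ A k)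
    {M : ℝ≥0∞} (hM : M ≠ ∞) (hAM : ∀ p, A p.1 * volume (B p) ≤ M)
    {Φ : 𝓢'(EuclideanSpace ℝ (Fin n), ℂ)}
    (hΦ : ∀ g : 𝓢(EuclideanSpace ℝ (Fin n), ℂ), HasSum (fun k => ∫ z, U k z * g z) (𝓕 Φ g)) :
    GeneratesBoundedHankel Ω Φ := by
  refine ⟨M.toReal, fun f hf => ?_⟩
  set F : 𝓢(EuclideanSpace ℝ (Fin n), ℂ) := 𝓕 f with hFdef
  set G : EuclideanSpace ℝ (Fin n) → ℂ := hankelIntegral Φ f with hGdef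
  have hG : ∀ x, HasSum (fun k => ∫ y, U k (x + y) * F y) (G x) := by
    intro x
    have h := hΦ (compSubConstCLM ℂ x F)
    change HasSum _ (𝓕 Φ (compSubConstCLM ℂ x F))
    convert h using 2 with k
    simp only [compSubConstCLM_apply]
    rw [← integral_add_left_eq_self (fun z => U k z * F (z - x)) x]
    simp
  have hFΩ : ∀ y, y ∉ Ω → F y = 0 := fun y hy =>
    image_eq_zero_of_notMem_tsupport fun h => hy (hf.2 h)
  have hGmeas : Measurable G := by
    have hterm : ∀ k, Measurable fun x => ∫ y, U k (x + y) * F y := by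
      intro k
      have : Continuous fun z : EuclideanSpace ℝ (Fin n) × EuclideanSpace ℝ (Fin n) =>
          U k (z.1 + z.2) * F z.2 := by fun_prop
      exact (this.stronglyMeasurable.integral_prod_right (ν := volume)).measurable
    refine measurable_of_tendsto_metrizable (f := fun N x => ∑ k ∈ Finset.range N,
      ∫ y, U k (x + y) * F y) (fun N => Finset.measurable_sum _ fun k _ => hterm k) ?_
    rw [tendsto_pi_nhds]
    exact fun x => (hG x).tendsto_sum_nat
  -- A term that does not vanish at `x` comes from a cap that contains `x`.
  have hcap : ∀ k, ∀ x ∈ Ω, ∀ y, U k (x + y) * F y ≠ 0 →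
      ∃ i, x + y ∈ B (k, i) ∧ x ∈ C (k, i) ∧ y ∈ C (k, i) ∧ y ∈ Ω := by
    intro k x hx y hne
    have hy : y ∈ Ω := by
      by_contra hy
      exact hne (by rw [hFΩ y hy, mul_zero])
    obtain ⟨i, hi⟩ := hsupp k _ (left_ne_zero_of_mul hne)
    exact ⟨i, hi, hBC _ x hx y hy hi, hBC _ y hy x hx (by rwa [add_comm]), hy⟩
  have hbound : ∫⁻ x in Ω, ‖G x‖ₑ ^ 2 ≤ M ^ 2 * ∫⁻ y, ‖F y‖ₑ ^ 2 := by
    refine lintegral_sq_le_of_blocks hΩ (A := fun p => A p.1) hC hdisj hB hAM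
      F.continuous.measurable.enorm ?_ ?_
    · intro x hx hxC
      rw [enorm_eq_zero]
      refine (hG x).unique ?_
      convert hasSum_zero with k
      refine integral_eq_zero_of_ae (ae_of_all _ fun y => ?_)
      by_contra hne
      obtain ⟨i, -, hi, -⟩ := hcap k x hx y hne
      exact hxC _ hi
    · rintro x hx ⟨k, i⟩ hp
      have huniq : ∀ l j, x ∈ C (l, j) → (l, j) = (k, i) := fun l j hl => by
        by_contra hne
        exact Set.disjoint_left.1 (hdisj hne) hl hp
      have hGx : G x = ∫ y, U k (x + y) * F y := by
        refine (hG x).unique (hasSum_single k fun l hl => ?_)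
        refine integral_eq_zero_of_ae (ae_of_all _ fun y => ?_)
        by_contra hne
        obtain ⟨j, -, hj, -⟩ := hcap l x hx y hne
        exact hl (congrArg Prod.fst (huniq l j hj))
      rw [hGx]
      refine (enorm_integral_le_lintegral_enorm _).trans ?_
      have hTm : MeasurableSet (C (k, i) ∩ {y | x + y ∈ B (k, i)}) :=
        (hC _).inter ((measurable_const_add x) (hB _))
      rw [← lintegral_const_mul _ F.continuous.measurable.enorm, ← lintegral_indicator hTm]
      refine lintegral_mono fun y => ?_
      by_cases hne : U k (x + y) * F y = 0
      · rw [hne, enorm_zero]; exact zero_le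
      · obtain ⟨j, hj, hjx, hjy, hyΩ⟩ := hcap k x hx y hne
        have hij := huniq k j hjx
        rw [hij] at hj hjy
        rw [Set.indicator_of_mem (show y ∈ C (k, i) ∩ {y | x + y ∈ B (k, i)} from ⟨hjy, hj⟩),
          enorm_mul]
        gcongr
        exact hA k x hx y hyΩ
  have hnorm : eLpNorm (Ω.indicator G) 2 volume ≤ M * eLpNorm F 2 volume := by
    rw [eLpNorm_indicator_eq_eLpNorm_restrict hΩ]
    have e : ∀ (H : EuclideanSpace ℝ (Fin n) → ℂ) (μ : Measure (EuclideanSpace ℝ (Fin n))),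
        eLpNorm H 2 μ = (∫⁻ x, ‖H x‖ₑ ^ 2 ∂μ) ^ (1 / 2 : ℝ) := fun H μ => by
      rw [eLpNorm_eq_lintegral_rpow_enorm_toReal two_ne_zero ENNReal.ofNat_ne_top]
      simp
    rw [e, e]
    calc _ ≤ (M ^ 2 * ∫⁻ y, ‖F y‖ₑ ^ 2) ^ (1 / 2 : ℝ) := by gcongr
      _ = _ := by
        rw [ENNReal.mul_rpow_of_nonneg _ _ (by norm_num), ← ENNReal.rpow_natCast,
          ← ENNReal.rpow_mul]
        norm_num
  have hmem : MemLp (Ω.indicator G) 2 volume :=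
    ⟨(hGmeas.indicator hΩ).aestronglyMeasurable,
      hnorm.trans_lt (ENNReal.mul_lt_top hM.lt_top (F.eLpNorm_lt_top 2 volume))⟩
  have hh : 𝓕 (𝓕⁻ hmem.toLp : Lp ℂ 2 (volume : Measure (EuclideanSpace ℝ (Fin n)))) =
      hmem.toLp := fourier_fourierInv_eq _
  refine ⟨𝓕⁻ hmem.toLp, ⟨?_, ?_⟩, ?_⟩
  · change ∀ᵐ x, x ∉ Ω → _ = _
    rw [hh]
    filter_upwards [hmem.coeFn_toLp] with x hx hxΩ
    rw [hx, Set.indicator_of_notMem hxΩ]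
  · rw [hh]
    filter_upwards [hmem.coeFn_toLp] with x hx hxΩ
    rw [hx, Set.indicator_of_mem hxΩ]
  · rw [← Lp.norm_fourier_eq, hh, Lp.norm_toLp, ← norm_fourier_toL2_eq, norm_toLp,
      ← ENNReal.toReal_mul]
    exact ENNReal.toReal_mono (ENNReal.mul_ne_top hM (F.eLpNorm_lt_top 2 volume).ne) hnorm

end BlockOperator

/-! ### Sums of bump functions -/

section BumpSums

variable {n : ℕ}

/-- A smooth bump function as a complex valued Schwartz function. -/
noncomputable def ContDiffBump.toSchwartz {c : EuclideanSpace ℝ (Fin n)} (b : ContDiffBump c) :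
    𝓢(EuclideanSpace ℝ (Fin n), ℂ) :=
  (b.hasCompactSupport.comp_left (g := ((↑) : ℝ → ℂ)) Complex.ofReal_zero).toSchwartzMap
    (Complex.ofRealCLM.contDiff.comp b.contDiff)

/-- A sum of `N` bumps around the points `a i` that equal `1` up to distance `r` and vanish from
distance `R` on. -/
noncomputable def bumpSum (a : ℕ → EuclideanSpace ℝ (Fin n)) (N : ℕ) {r R : ℝ} (hr : 0 < r)
    (hR : r < R) (x : EuclideanSpace ℝ (Fin n)) : ℝ :=
  ∑ i ∈ Finset.range N, (⟨r, R, hr, hR⟩ : ContDiffBump (a i)) x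

/-- `bumpSum` as a complex valued Schwartz function. -/
noncomputable def bumpSumSchwartz (a : ℕ → EuclideanSpace ℝ (Fin n)) (N : ℕ) {r R : ℝ} (hr : 0 < r)
    (hR : r < R) : 𝓢(EuclideanSpace ℝ (Fin n), ℂ) :=
  ∑ i ∈ Finset.range N, (⟨r, R, hr, hR⟩ : ContDiffBump (a i)).toSchwartz

variable {a : ℕ → EuclideanSpace ℝ (Fin n)} {N : ℕ} {r R : ℝ} {hr : 0 < r} {hR : r < R}

@[simp]
lemma bumpSumSchwartz_apply (x : EuclideanSpace ℝ (Fin n)) :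
    bumpSumSchwartz a N hr hR x = (bumpSum a N hr hR x : ℂ) := by
  rw [bumpSumSchwartz, bumpSum, Complex.ofReal_sum]
  rw [show (⇑(∑ i ∈ Finset.range N, (⟨r, R, hr, hR⟩ : ContDiffBump (a i)).toSchwartz)) x =
    ∑ i ∈ Finset.range N, (⟨r, R, hr, hR⟩ : ContDiffBump (a i)).toSchwartz x by simp]
  rfl

lemma bumpSum_nonneg (x : EuclideanSpace ℝ (Fin n)) : 0 ≤ bumpSum a N hr hR x :=
  Finset.sum_nonneg fun _ _ => ContDiffBump.nonneg _

lemma exists_mem_ball_of_bumpSum_ne_zero {x : EuclideanSpace ℝ (Fin n)}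
    (h : bumpSum a N hr hR x ≠ 0) : ∃ i < N, x ∈ Metric.ball (a i) R := by
  obtain ⟨i, hi, hne⟩ := Finset.exists_ne_zero_of_sum_ne_zero h
  refine ⟨i, Finset.mem_range.1 hi, ?_⟩
  rw [← (⟨r, R, hr, hR⟩ : ContDiffBump (a i)).support_eq]
  exact hne

lemma one_le_bumpSum {x : EuclideanSpace ℝ (Fin n)} {i : ℕ} (hi : i < N)
    (hx : x ∈ Metric.closedBall (a i) r) : 1 ≤ bumpSum a N hr hR x := by
  rw [← (⟨r, R, hr, hR⟩ : ContDiffBump (a i)).one_of_mem_closedBall hx]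
  exact Finset.single_le_sum
    (f := fun i => (⟨r, R, hr, hR⟩ : ContDiffBump (a i)) x)
    (fun _ _ => ContDiffBump.nonneg _) (Finset.mem_range.2 hi)

lemma bumpSum_le_one {x : EuclideanSpace ℝ (Fin n)}
    (hx : ∀ i < N, ∀ j < N, x ∈ Metric.ball (a i) R → x ∈ Metric.ball (a j) R → i = j) :
    bumpSum a N hr hR x ≤ 1 := by
  by_cases h : bumpSum a N hr hR x = 0
  · rw [h]; exact zero_le_one
  obtain ⟨i, hi, hxi⟩ := exists_mem_ball_of_bumpSum_ne_zero h
  rw [bumpSum, Finset.sum_eq_single_of_mem i (Finset.mem_range.2 hi)]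
  · exact ContDiffBump.le_one _
  · intro j hj hji
    refine ContDiffBump.zero_of_le_dist _ (not_lt.1 fun h => hji ?_)
    exact hx j (Finset.mem_range.1 hj) i hi h hxi

lemma integrable_bumpSum : Integrable (bumpSum a N hr hR) :=
  integrable_finsetSum _ fun _ _ =>
    (ContDiffBump.continuous _).integrable_of_hasCompactSupport (ContDiffBump.hasCompactSupport _)

lemma volume_real_closedBall_eq (c : EuclideanSpace ℝ (Fin n)) {s : ℝ} (hs : 0 ≤ s) :
    volume.real (Metric.closedBall c s) =
      s ^ n * volume.real (Metric.ball (0 : EuclideanSpace ℝ (Fin n)) 1) := by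
  rw [Measure.real, Measure.addHaar_closedBall volume c hs, ENNReal.toReal_mul,
    ENNReal.toReal_ofReal (by positivity), finrank_euclideanSpace, Fintype.card_fin, Measure.real]

lemma integral_bumpSum_le : ∫ x, bumpSum a N hr hR x ≤
    N * (R ^ n * volume.real (Metric.ball (0 : EuclideanSpace ℝ (Fin n)) 1)) := by
  unfold bumpSum
  rw [integral_finsetSum _ fun _ _ => (ContDiffBump.continuous _).integrable_of_hasCompactSupport
    (ContDiffBump.hasCompactSupport _)]
  calc _ ≤ ∑ i ∈ Finset.range N,
        R ^ n * volume.real (Metric.ball (0 : EuclideanSpace ℝ (Fin n)) 1) := by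
        refine Finset.sum_le_sum fun i _ => ?_
        rw [← volume_real_closedBall_eq (a i) (hr.trans hR).le]
        exact ContDiffBump.integral_le_measure_closedBall _ _
    _ = _ := by simp

lemma le_integral_bumpSum :
    N * (r ^ n * volume.real (Metric.ball (0 : EuclideanSpace ℝ (Fin n)) 1)) ≤
      ∫ x, bumpSum a N hr hR x := by
  unfold bumpSum
  rw [integral_finsetSum _ fun _ _ => (ContDiffBump.continuous _).integrable_of_hasCompactSupport
    (ContDiffBump.hasCompactSupport _)]
  calc _ = ∑ i ∈ Finset.range N,
        r ^ n * volume.real (Metric.ball (0 : EuclideanSpace ℝ (Fin n)) 1) := by simp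
    _ ≤ _ := by
        refine Finset.sum_le_sum fun i _ => ?_
        rw [← volume_real_closedBall_eq (a i) hr.le]
        exact (⟨r, R, hr, hR⟩ : ContDiffBump (a i)).measure_closedBall_le_integral volume

/-- The sum of bumps around `a i` smeared out by a further bump around the origin. Being a
convolution, it has a Fourier transform whose `L¹` norm is controlled by `L²` norms. -/
noncomputable def smearedBumps (a : ℕ → EuclideanSpace ℝ (Fin n)) (N : ℕ) {r R : ℝ} (hr : 0 < r)
    (hR : r < R) : 𝓢(EuclideanSpace ℝ (Fin n), ℂ) :=
  SchwartzMap.convolution (ContinuousLinearMap.mul ℂ ℂ) (bumpSumSchwartz a N hr hR)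
    (bumpSumSchwartz 0 1 hr hR)

lemma smearedBumps_apply (x : EuclideanSpace ℝ (Fin n)) :
    smearedBumps a N hr hR x =
      ((convolution (bumpSum a N hr hR) (bumpSum 0 1 hr hR) (ContinuousLinearMap.mul ℝ ℝ) volume x :
        ℝ) : ℂ) := by
  rw [smearedBumps, SchwartzMap.convolution_apply, convolution_def, convolution_def,
    ← integral_complex_ofReal]
  simp

lemma convolution_bumpSum_nonneg (x : EuclideanSpace ℝ (Fin n)) :
    0 ≤ convolution (bumpSum a N hr hR) (bumpSum 0 1 hr hR) (ContinuousLinearMap.mul ℝ ℝ)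
      volume x :=
  integral_nonneg fun _ => mul_nonneg (bumpSum_nonneg _) (bumpSum_nonneg _)

lemma exists_mem_ball_of_smearedBumps_ne_zero {x : EuclideanSpace ℝ (Fin n)}
    (h : smearedBumps a N hr hR x ≠ 0) : ∃ i < N, x ∈ Metric.ball (a i) (2 * R) := by
  rw [smearedBumps_apply, Complex.ofReal_ne_zero] at h
  obtain ⟨y, hy, z, hz, rfl⟩ := support_convolution_subset _ (Function.mem_support.2 h)
  obtain ⟨i, hi, hyi⟩ := exists_mem_ball_of_bumpSum_ne_zero hy
  obtain ⟨j, -, hzj⟩ := exists_mem_ball_of_bumpSum_ne_zero hz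
  refine ⟨i, hi, ?_⟩
  rw [Pi.zero_apply, mem_ball_zero_iff] at hzj
  rw [mem_ball_iff_norm] at hyi ⊢
  calc ‖y + z - a i‖ = ‖(y - a i) + z‖ := by congr 1; abel
    _ ≤ ‖y - a i‖ + ‖z‖ := norm_add_le _ _
    _ < 2 * R := by linarith

lemma integral_norm_sq_bumpSumSchwartz_le
    (ha : ∀ x, ∀ i < N, ∀ j < N, x ∈ Metric.ball (a i) R → x ∈ Metric.ball (a j) R → i = j) :
    ∫ x, ‖bumpSumSchwartz a N hr hR x‖ ^ 2 ≤
      N * (R ^ n * volume.real (Metric.ball (0 : EuclideanSpace ℝ (Fin n)) 1)) := by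
  refine le_trans (integral_mono_of_nonneg (ae_of_all _ fun x => by positivity)
    (integrable_bumpSum (a := a) (N := N) (hr := hr) (hR := hR)) (ae_of_all _ fun x => ?_))
    integral_bumpSum_le
  simp only [bumpSumSchwartz_apply, Complex.norm_real, Real.norm_of_nonneg (bumpSum_nonneg x)]
  nlinarith [bumpSum_le_one (hr := hr) (hR := hR) (ha x),
    bumpSum_nonneg (a := a) (N := N) (hr := hr) (hR := hR) x]

/-- The `L¹` norm of the Fourier transform of `N` well separated smeared bumps grows like `√N` only,
by Plancherel's theorem. -/
lemma integral_norm_fourier_smearedBumps_le (hN : 0 < N)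
    (ha : ∀ x, ∀ i < N, ∀ j < N, x ∈ Metric.ball (a i) R → x ∈ Metric.ball (a j) R → i = j) :
    ∫ ξ, ‖𝓕 (smearedBumps a N hr hR) ξ‖ ≤
      √N * (R ^ n * volume.real (Metric.ball (0 : EuclideanSpace ℝ (Fin n)) 1)) := by
  set v := R ^ n * volume.real (Metric.ball (0 : EuclideanSpace ℝ (Fin n)) 1)
  set p := bumpSumSchwartz a N hr hR
  set q := bumpSumSchwartz (0 : ℕ → EuclideanSpace ℝ (Fin n)) 1 hr hR
  have hp : ∫ ξ, ‖𝓕 p ξ‖ ^ 2 ≤ N * v := by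
    rw [integral_norm_sq_fourier]
    exact integral_norm_sq_bumpSumSchwartz_le ha
  have hq : ∫ ξ, ‖𝓕 q ξ‖ ^ 2 ≤ v := by
    rw [integral_norm_sq_fourier]
    refine (integral_norm_sq_bumpSumSchwartz_le fun x i hi j hj _ _ => by lia).trans_eq ?_
    rw [Nat.cast_one, one_mul]
  have hsq : ∀ f : 𝓢(EuclideanSpace ℝ (Fin n), ℂ), Integrable fun ξ => ‖f ξ‖ ^ 2 := fun f =>
    (f.memLp 2 volume).integrable_norm_pow two_ne_zero
  have hs : 0 < √(N : ℝ) := Real.sqrt_pos.2 (by exact_mod_cast hN)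
  have hss : √(N : ℝ) * √(N : ℝ) = N := Real.mul_self_sqrt (Nat.cast_nonneg N)
  -- The weight `√N` in the inequality of arithmetic and geometric means balances the `L²` norms
  -- of `p` and `q`.
  calc ∫ ξ, ‖𝓕 (smearedBumps a N hr hR) ξ‖
      ≤ ∫ ξ, ((2 * √(N : ℝ))⁻¹ * ‖𝓕 p ξ‖ ^ 2 + √(N : ℝ) / 2 * ‖𝓕 q ξ‖ ^ 2) := by
        refine integral_mono (SchwartzMap.integrable _).norm
          (((hsq _).const_mul _).add ((hsq _).const_mul _)) fun ξ => ?_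
        have h1 : 𝓕 (smearedBumps a N hr hR) ξ = 𝓕 p ξ * 𝓕 q ξ := by
          rw [smearedBumps, fourier_convolution]
          simp [p, q]
        simp only
        rw [h1, norm_mul]
        have h2 : (2 * √(N : ℝ))⁻¹ * ‖𝓕 p ξ‖ ^ 2 + √(N : ℝ) / 2 * ‖𝓕 q ξ‖ ^ 2 -
            ‖𝓕 p ξ‖ * ‖𝓕 q ξ‖ =
            (2 * √(N : ℝ))⁻¹ * (‖𝓕 p ξ‖ - √(N : ℝ) * ‖𝓕 q ξ‖) ^ 2 := by
          field_simp
          ring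
        have h3 : 0 ≤ (2 * √(N : ℝ))⁻¹ * (‖𝓕 p ξ‖ - √(N : ℝ) * ‖𝓕 q ξ‖) ^ 2 := by positivity
        linarith
    _ = (2 * √(N : ℝ))⁻¹ * (∫ ξ, ‖𝓕 p ξ‖ ^ 2) + √(N : ℝ) / 2 * ∫ ξ, ‖𝓕 q ξ‖ ^ 2 := by
        rw [integral_add ((hsq _).const_mul _) ((hsq _).const_mul _), integral_const_mul,
          integral_const_mul]
    _ ≤ (2 * √(N : ℝ))⁻¹ * (N * v) + √(N : ℝ) / 2 * v := by gcongr
    _ = √N * v := by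
        have h4 : (N : ℝ) * v = √(N : ℝ) * √(N : ℝ) * v := by rw [hss]
        rw [h4]
        field_simp
        ring

/-- Paired with a sum of wider bumps, `N` smeared bumps give at least `N` times the contribution of
one of them. -/
lemma le_norm_integral_mul_smearedBumps {r' R' : ℝ} {hr' : 0 < r'} {hR' : r' < R'}
    (hRr : 2 * R ≤ r') :
    N * (r ^ n * volume.real (Metric.ball (0 : EuclideanSpace ℝ (Fin n)) 1)) ^ 2 ≤
      ‖∫ x, bumpSumSchwartz a N hr' hR' x * smearedBumps a N hr hR x‖ := by
  set v := r ^ n * volume.real (Metric.ball (0 : EuclideanSpace ℝ (Fin n)) 1) with hv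
  have hv0 : 0 ≤ v := by positivity
  have h1 : ∀ x, bumpSumSchwartz a N hr' hR' x * smearedBumps a N hr hR x =
      ((bumpSum a N hr' hR' x * convolution (bumpSum a N hr hR) (bumpSum 0 1 hr hR)
        (ContinuousLinearMap.mul ℝ ℝ) volume x : ℝ) : ℂ) := fun x => by
    rw [bumpSumSchwartz_apply, smearedBumps_apply, Complex.ofReal_mul]
  have hint : Integrable fun x => bumpSum a N hr' hR' x *
      convolution (bumpSum a N hr hR) (bumpSum 0 1 hr hR) (ContinuousLinearMap.mul ℝ ℝ)
        volume x := by
    have h2 : Integrable fun x => bumpSumSchwartz a N hr' hR' x * smearedBumps a N hr hR x :=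
      (pairing (ContinuousLinearMap.mul ℂ ℂ) (bumpSumSchwartz a N hr' hR')
        (smearedBumps a N hr hR)).integrable
    simp_rw [h1] at h2
    exact h2.re
  simp_rw [h1]
  rw [integral_complex_ofReal, Complex.norm_real]
  refine le_trans ?_ (Real.le_norm_self _)
  calc N * v ^ 2 = (N * v) * ((1 : ℕ) * v) := by push_cast; ring
    _ ≤ (∫ x, bumpSum a N hr hR x) *
          ∫ x : EuclideanSpace ℝ (Fin n), bumpSum 0 1 hr hR x := by
        exact mul_le_mul le_integral_bumpSum le_integral_bumpSum (by positivity)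
          (integral_nonneg bumpSum_nonneg)
    _ = ∫ x, convolution (bumpSum a N hr hR) (bumpSum 0 1 hr hR) (ContinuousLinearMap.mul ℝ ℝ)
          volume x := by
        rw [integral_convolution _ integrable_bumpSum integrable_bumpSum]
        rfl
    _ ≤ _ := by
        refine integral_mono (integrable_bumpSum.integrable_convolution _ integrable_bumpSum)
          hint fun x => ?_
        by_cases hx : smearedBumps a N hr hR x = 0
        · rw [smearedBumps_apply, Complex.ofReal_eq_zero] at hx
          simp only [hx, mul_zero, le_refl]
        · obtain ⟨i, hi, hxi⟩ := exists_mem_ball_of_smearedBumps_ne_zero hx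
          refine le_mul_of_one_le_left (convolution_bumpSum_nonneg x) (one_le_bumpSum hi ?_)
          exact Metric.closedBall_subset_closedBall hRr (Metric.ball_subset_closedBall hxi)

end BumpSums

/-! ### Failure of the Nehari theorem -/

section Failure

variable {n : ℕ}

/-- A bounded function, as a distribution, is controlled by the `L¹` norm of the test function. -/
lemma norm_toTemperedDistribution_apply_le
    (ψ : Lp ℂ ∞ (volume : Measure (EuclideanSpace ℝ (Fin n))))
    (g : 𝓢(EuclideanSpace ℝ (Fin n), ℂ)) :
    ‖Lp.toTemperedDistribution ψ g‖ ≤ ‖ψ‖ * ∫ x, ‖g x‖ := by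
  rw [Lp.toTemperedDistribution_apply, ← integral_const_mul]
  refine norm_integral_le_of_norm_le (g.integrable.norm.const_mul _) ?_
  have hψ : ∀ᵐ x, ‖ψ x‖ₑ ≤ eLpNorm ψ ∞ volume := by
    rw [eLpNorm_exponent_top]
    exact ae_le_eLpNormEssSup
  filter_upwards [hψ] with x hx
  have hx' : ‖ψ x‖ ≤ ‖ψ‖ := by
    rw [Lp.norm_def, ← toReal_enorm]
    exact ENNReal.toReal_mono (Lp.memLp ψ).eLpNorm_ne_top hx
  rw [norm_smul, mul_comm]
  gcongr

/-- The modulation by `τ` of the Schwartz function `r`, defined as a translation on the Fourier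
side. -/
noncomputable def modulate (τ : EuclideanSpace ℝ (Fin n))
    (r : 𝓢(EuclideanSpace ℝ (Fin n), ℂ)) : 𝓢(EuclideanSpace ℝ (Fin n), ℂ) :=
  𝓕⁻ (compSubConstCLM ℂ τ (𝓕 r))

lemma norm_modulate (τ x : EuclideanSpace ℝ (Fin n)) (r : 𝓢(EuclideanSpace ℝ (Fin n), ℂ)) :
    ‖modulate τ r x‖ = ‖r x‖ := by
  rw [modulate, norm_fourierInv_compSubConstCLM, fourierInv_fourier_eq]

lemma modulate_ne_zero_iff {τ x : EuclideanSpace ℝ (Fin n)}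
    {r : 𝓢(EuclideanSpace ℝ (Fin n), ℂ)} : modulate τ r x ≠ 0 ↔ r x ≠ 0 := by
  rw [← norm_ne_zero_iff, norm_modulate, norm_ne_zero_iff]

lemma fourier_modulate (τ ξ : EuclideanSpace ℝ (Fin n)) (r : 𝓢(EuclideanSpace ℝ (Fin n), ℂ)) :
    𝓕 (modulate τ r) ξ = 𝓕 r (ξ - τ) := by
  rw [modulate, fourier_fourierInv_eq, compSubConstCLM_apply]

/-- The Nehari theorem fails for an open set with infinitely many disjoint caps `C i`, each seen by
the sums `x + y` that fall into a ball around `2 • c i`. -/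
theorem not_nehariHolds_of_disjoint_caps [Nontrivial (EuclideanSpace ℝ (Fin n))]
    {Ω : Set (EuclideanSpace ℝ (Fin n))} (hopen : IsOpen Ω)
    {C : ℕ → Set (EuclideanSpace ℝ (Fin n))} {c : ℕ → EuclideanSpace ℝ (Fin n)} {δ : ℕ → ℝ}
    (hC : ∀ i, IsOpen (C i)) (hdisj : Pairwise (Function.onFun Disjoint C)) (hδ : ∀ i, 0 < δ i)
    (hball : ∀ i, Metric.ball (c i) (δ i) ⊆ Ω)
    (hcap : ∀ i, ∀ x ∈ Ω, ∀ y ∈ Ω, x + y ∈ Metric.ball ((2 : ℝ) • c i) (3 * δ i) → x ∈ C i) :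
    ¬ NehariHolds Ω := by
  -- The bumps of the `k`-th block share the radius `d k`; the factor `2` leaves room for closed
  -- balls inside the given open ones.
  have hd : ∀ k, ∃ d > 0, ∀ i < k + 1, 2 * d ≤ δ (Nat.pair k i) := by
    intro k
    obtain ⟨j, -, hj⟩ := Finset.exists_min_image (Finset.range (k + 1))
      (fun i => δ (Nat.pair k i)) ⟨0, by simp⟩
    refine ⟨δ (Nat.pair k j) / 2, half_pos (hδ _), fun i hi => ?_⟩
    linarith [hj i (Finset.mem_range.2 hi)]
  choose d hd0 hdδ using hd
  set ν := volume.real (Metric.ball (0 : EuclideanSpace ℝ (Fin n)) 1) with hν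
  have hν0 : 0 < ν := ENNReal.toReal_pos
    (Metric.measure_ball_pos volume _ one_pos).ne' measure_ball_lt_top.ne
  -- The `k`-th block uses the caps with the indices `Nat.pair k i`, `i ≤ k`.
  set a : ℕ → ℕ → EuclideanSpace ℝ (Fin n) := fun k i => (2 : ℝ) • c (Nat.pair k i) with ha
  have hmemC : ∀ k, ∀ i < k + 1, ∀ x ∈ Ω, ∀ y ∈ Ω, x + y ∈ Metric.ball (a k i) (3 * d k) →
      x ∈ C (Nat.pair k i) := fun k i hi x hx y hy h =>
    hcap _ x hx y hy (Metric.ball_subset_ball (by linarith [hdδ k i hi, hd0 k]) h)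
  have hhalf : ∀ k, ∀ i < k + 1, ∀ z ∈ Metric.closedBall (a k i) (2 * d k),
      ∃ x ∈ Ω, z = x + x := by
    intro k i hi z hz
    refine ⟨(2 : ℝ)⁻¹ • z, hball (Nat.pair k i) ?_,
      by rw [← two_smul ℝ, smul_inv_smul₀ two_ne_zero]⟩
    rw [mem_closedBall_iff_norm] at hz
    have h1 : (2 : ℝ)⁻¹ • z - c (Nat.pair k i) = (2 : ℝ)⁻¹ • (z - a k i) := by
      rw [smul_sub, ha, inv_smul_smul₀ two_ne_zero]
    rw [mem_ball_iff_norm, h1, norm_smul, Real.norm_of_nonneg (by norm_num)]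
    linarith [hdδ k i hi, hd0 k]
  have hsep : ∀ k, ∀ x ∈ Ω, ∀ y ∈ Ω, ∀ l, ∀ i < k + 1, ∀ j < l + 1,
      x + y ∈ Metric.ball (a k i) (3 * d k) → x + y ∈ Metric.ball (a l j) (3 * d l) →
      k = l ∧ i = j := by
    intro k x hx y hy l i hi j hj h1 h2
    by_contra hne
    refine Set.disjoint_left.1 (hdisj (i := Nat.pair k i) (j := Nat.pair l j) ?_)
      (hmemC k i hi x hx y hy h1) (hmemC l j hj x hx y hy h2)
    rwa [Ne, Nat.pair_eq_pair]
  set s : ∀ k, 𝓢(EuclideanSpace ℝ (Fin n), ℂ) := fun k =>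
    bumpSumSchwartz (a k) (k + 1) (r := 2 * d k) (R := 3 * d k) (by linarith [hd0 k])
      (by linarith [hd0 k]) with hs
  set u : ∀ k, 𝓢(EuclideanSpace ℝ (Fin n), ℂ) := fun k => (((d k ^ n)⁻¹ : ℝ) : ℂ) • s k with hu
  have hunorm : ∀ k z, ‖u k z‖ = (d k ^ n)⁻¹ * bumpSum (a k) (k + 1) (r := 2 * d k)
      (R := 3 * d k) (by linarith [hd0 k]) (by linarith [hd0 k]) z := by
    intro k z
    have := hd0 k
    rw [hu]
    simp only [smul_apply, norm_smul, Complex.norm_real]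
    rw [Real.norm_of_nonneg (by positivity), hs, bumpSumSchwartz_apply, Complex.norm_real,
      Real.norm_of_nonneg (bumpSum_nonneg _)]
  have husupp : ∀ k z, u k z ≠ 0 → ∃ i < k + 1, z ∈ Metric.ball (a k i) (3 * d k) := by
    intro k z hz
    rw [← norm_ne_zero_iff, hunorm] at hz
    exact exists_mem_ball_of_bumpSum_ne_zero (right_ne_zero_of_mul hz)
  -- Translations that move the blocks of the symbol far apart make their sum converge.
  have hτ : ∀ k, ∃ τ : EuclideanSpace ℝ (Fin n), ∀ ξ,
      ‖(𝓕⁻ (u k)) (ξ - τ)‖ ≤ (1 / 2) ^ k * (1 + ‖ξ‖ ^ 2) := fun k =>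
    exists_translate_norm_le _ (by positivity)
  choose τ hτ using hτ
  set φ : ℕ → 𝓢(EuclideanSpace ℝ (Fin n), ℂ) := fun k => compSubConstCLM ℂ (τ k) (𝓕⁻ (u k))
    with hφ
  obtain ⟨Φ, hΦ⟩ := exists_temperedDistribution_hasSum φ hτ
  have hΦ' : ∀ g : 𝓢(EuclideanSpace ℝ (Fin n), ℂ),
      HasSum (fun k => ∫ z, 𝓕 (φ k) z * g z) (𝓕 Φ g) := by
    intro g
    rw [TemperedDistribution.fourier_apply]
    convert hΦ (𝓕 g) using 2 with k
    exact integral_fourier_mul_eq _ _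
  have hUnorm : ∀ k z, ‖𝓕 (φ k) z‖ = ‖u k z‖ := fun k z => by
    rw [hφ, norm_fourier_compSubConstCLM, fourier_fourierInv_eq]
  have hUsupp : ∀ k z, 𝓕 (φ k) z ≠ 0 → ∃ i < k + 1, z ∈ Metric.ball (a k i) (3 * d k) :=
    fun k z hz => husupp k z (by rwa [← norm_ne_zero_iff, ← hUnorm, norm_ne_zero_iff])
  have hbdd : GeneratesBoundedHankel Ω Φ := by
    refine generatesBoundedHankel_of_blocks hopen.measurableSet
      (C := fun p => C (Nat.pair p.1 p.2))
      (B := fun p => {z | p.2 < p.1 + 1 ∧ z ∈ Metric.ball (a p.1 p.2) (3 * d p.1)})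
      (A := fun k => ENNReal.ofReal (d k ^ n)⁻¹)
      (M := ENNReal.ofReal (3 ^ n) * volume (Metric.ball (0 : EuclideanSpace ℝ (Fin n)) 1))
      (fun p => (hC _).measurableSet) ?_ ?_ ?_ ?_ ?_ ?_ ?_ hΦ'
    · rintro ⟨k, i⟩ ⟨l, j⟩ hne
      refine hdisj fun h => hne ?_
      rw [Nat.pair_eq_pair] at h
      exact Prod.ext h.1 h.2
    · intro p
      exact (MeasurableSet.const _).inter measurableSet_ball
    · rintro p x hx y hy ⟨hp, h⟩
      exact hmemC p.1 p.2 hp x hx y hy h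
    · intro k z hz
      obtain ⟨i, hi, h⟩ := hUsupp k z hz
      exact ⟨i, hi, h⟩
    · intro k x hx y hy
      rw [← ofReal_norm, hUnorm, hunorm]
      have := hd0 k
      refine ENNReal.ofReal_le_ofReal (mul_le_of_le_one_right (by positivity) ?_)
      exact bumpSum_le_one fun i hi j hj h1 h2 => (hsep k x hx y hy k i hi j hj h1 h2).2
    · exact ENNReal.mul_ne_top ENNReal.ofReal_ne_top measure_ball_lt_top.ne
    · rintro ⟨k, i⟩
      have := hd0 k
      calc ENNReal.ofReal (d k ^ n)⁻¹ *
            volume {z | i < k + 1 ∧ z ∈ Metric.ball (a k i) (3 * d k)}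
          ≤ ENNReal.ofReal (d k ^ n)⁻¹ * volume (Metric.ball (a k i) (3 * d k)) := by
            gcongr
            exact fun z hz => hz.2
        _ = _ := by
            rw [Measure.addHaar_ball_of_pos volume _ (by positivity), ← mul_assoc,
              ← ENNReal.ofReal_mul (by positivity), finrank_euclideanSpace, Fintype.card_fin]
            congr 2
            rw [mul_pow]
            field_simp
  intro hNehari
  obtain ⟨ψ, hψ⟩ := hNehari Φ hbdd
  -- Testing against the `k`-th block shows `√(k + 1) ≲ ‖ψ‖`.
  have hlower : ∀ k : ℕ, √((k : ℝ) + 1) * ν ≤ 4 ^ n * ‖ψ‖ := by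
    intro k
    have hdk := hd0 k
    set r := smearedBumps (a k) (k + 1) (r := d k / 2) (R := d k) (by linarith) (by linarith)
      with hr
    have hrsupp : ∀ x, r x ≠ 0 → ∃ i < k + 1, x ∈ Metric.ball (a k i) (2 * d k) := fun x hx =>
      exists_mem_ball_of_smearedBumps_ne_zero hx
    set g := modulate (τ k) r with hg
    set K := ⋃ i ∈ Finset.range (k + 1), Metric.closedBall (a k i) (2 * d k) with hK
    have hKc : IsCompact K := (Finset.range (k + 1)).isCompact_biUnion
      fun i _ => isCompact_closedBall _ _
    have hgK : Function.support g ⊆ K := by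
      intro x hx
      obtain ⟨i, hi, h⟩ := hrsupp x (modulate_ne_zero_iff.1 hx)
      exact Set.mem_biUnion (Finset.mem_coe.2 (Finset.mem_range.2 hi))
        (Metric.ball_subset_closedBall h)
    have hKΩ : K ⊆ (2 : ℝ) • Ω := by
      intro z hz
      obtain ⟨i, hi, h⟩ := Set.mem_iUnion₂.1 hz
      obtain ⟨x, hx, rfl⟩ := hhalf k i (Finset.mem_range.1 hi) z h
      exact ⟨x, hx, two_smul ℝ x⟩
    have heq := hψ g (HasCompactSupport.of_support_subset_isCompact hKc hgK)
      ((closure_minimal hgK hKc.isClosed).trans hKΩ)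
    have hval : 𝓕 Φ g = ∫ x, u k x * r x := by
      refine ((hΦ' g).unique (hasSum_single k fun l hl => ?_)).trans ?_
      · refine integral_eq_zero_of_ae (ae_of_all _ fun z => ?_)
        by_contra hne
        have hne' : 𝓕 (φ l) z * g z ≠ 0 := hne
        obtain ⟨i, hi, h1⟩ := hrsupp z (modulate_ne_zero_iff.1 (right_ne_zero_of_mul hne'))
        obtain ⟨j, hj, h2⟩ := hUsupp l z (left_ne_zero_of_mul hne')
        obtain ⟨x, hx, rfl⟩ := hhalf k i hi z (Metric.ball_subset_closedBall h1)
        exact hl (hsep k x hx x hx l i hi j hj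
          (Metric.ball_subset_ball (by linarith) h1) h2).1.symm
      · rw [integral_fourier_mul_eq]
        have h1 : ∀ ξ, φ k ξ * 𝓕 g ξ = (𝓕⁻ (u k)) (ξ - τ k) * 𝓕 r (ξ - τ k) := fun ξ => by
          rw [hg, fourier_modulate, hφ, compSubConstCLM_apply]
        simp_rw [h1]
        rw [integral_sub_right_eq_self (fun ξ =>
          (𝓕⁻ (u k) : 𝓢(EuclideanSpace ℝ (Fin n), ℂ)) ξ * 𝓕 r ξ) (τ k),
          ← integral_fourier_mul_eq, fourier_fourierInv_eq]
    have hup : ‖𝓕 Φ g‖ ≤ ‖ψ‖ * (√((k : ℝ) + 1) * (d k ^ n * ν)) := by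
      rw [heq, TemperedDistribution.fourier_apply]
      refine (norm_toTemperedDistribution_apply_le ψ _).trans ?_
      gcongr
      simp_rw [hg, fourier_modulate]
      rw [integral_sub_right_eq_self (fun ξ => ‖𝓕 r ξ‖) (τ k), ← Nat.cast_succ]
      refine integral_norm_fourier_smearedBumps_le (Nat.succ_pos k) fun x i hi j hj h1 h2 => ?_
      obtain ⟨y, hy, rfl⟩ := hhalf k i hi x
        (Metric.ball_subset_closedBall (Metric.ball_subset_ball (by linarith) h1))
      exact (hsep k y hy y hy k i hi j hj (Metric.ball_subset_ball (by linarith) h1)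
        (Metric.ball_subset_ball (by linarith) h2)).2
    have hlow : (d k ^ n)⁻¹ * (((k : ℝ) + 1) * ((d k / 2) ^ n * ν) ^ 2) ≤ ‖𝓕 Φ g‖ := by
      have h1 : ∀ x, u k x * r x = (((d k ^ n)⁻¹ : ℝ) : ℂ) * (s k x * r x) := fun x => by
        rw [hu]
        simp only [smul_apply, smul_eq_mul, mul_assoc]
      rw [hval]
      simp_rw [h1]
      rw [integral_const_mul, norm_mul, Complex.norm_real, Real.norm_of_nonneg (by positivity),
        ← Nat.cast_succ]
      gcongr
      exact le_norm_integral_mul_smearedBumps le_rfl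
    have h := hlow.trans hup
    set q := √((k : ℝ) + 1) with hq
    have hq0 : 0 < q := Real.sqrt_pos.2 (by positivity)
    have hqq : (k : ℝ) + 1 = q * q := (Real.mul_self_sqrt (by positivity)).symm
    have h4 : ((d k / 2) ^ n) ^ 2 = d k ^ n * d k ^ n / 4 ^ n := by
      rw [div_pow, div_pow, ← pow_mul, ← pow_mul, ← pow_add, mul_comm n 2, pow_mul 2 2 n]
      norm_num
      ring
    rw [hqq, mul_pow, h4] at h
    have hpos : 0 < q * (d k ^ n * ν) := by positivity
    have h5 : (d k ^ n)⁻¹ * (q * q * (d k ^ n * d k ^ n / 4 ^ n * ν ^ 2)) =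
        q * ν / 4 ^ n * (q * (d k ^ n * ν)) := by
      field_simp
    rw [h5] at h
    have h6 := le_of_mul_le_mul_right h hpos
    rwa [div_le_iff₀' (by positivity)] at h6
  obtain ⟨k, hk⟩ := exists_nat_gt ((4 ^ n * ‖ψ‖ / ν) ^ 2)
  have h1 : 4 ^ n * ‖ψ‖ / ν < √((k : ℝ) + 1) :=
    Real.lt_sqrt_of_sq_lt (hk.trans (lt_add_one _))
  rw [div_lt_iff₀ hν0] at h1
  exact absurd (hlower k) (not_le.2 h1)

end Failure

/-- The Nehari theorem fails for every nonempty open convex subset of the plane, bounded or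
unbounded, whose closure is not a polyhedron. -/
theorem corollary2 (Ω : Set (EuclideanSpace ℝ (Fin 2))) (hne : Ω.Nonempty) (hopen : IsOpen Ω)
    (hconv : Convex ℝ Ω) (hpoly : ¬ IsPolyhedron (closure Ω)) : ¬ NehariHolds Ω := by
  obtain ⟨C, c, δ, hC, hdisj, hδ, hball, hcap⟩ := exists_disjoint_caps hne hopen hconv hpoly
  exact not_nehariHolds_of_disjoint_caps hopen hC hdisj hδ hball hcap
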